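/- \textbf{Theorem (Generix and the Cosets).} Let $G$ be a connected group of finite Morley rank in which, generically, elements belong to connected nilpotent subgroups. Then for every definable subgroup $H$ of $G$ and every $w\in N_G(H)\setminus H$, the coset $wH$ is not generous in $G$, i.e. the union $\bigcup_{g\in G}(wH)^g$ of its conjugates is not generic in $G$. Here the terms have the following meaning. Definable means first-order definable with parameters; an interpretable set is a definable subset of a quotient of a finite Cartesian power of the structure by a definable equivalence relation. The rank of definable and interpretable sets is given by: $\mathrm{rk}(X)\ge 0$ iff $X\neq\emptyset$, and $\mathrm{rk}(X)\ge n+1$ iff $X$ contains infinitely many pairwise disjoint definable subsets of rank at least $n$. A \emph{group of finite Morley rank} is a group $G$, given with a (possibly richer) first-order structure in which its multiplication is definable, that satisfies the Borovik--Poizat axioms: every nonempty interpretable set has finite rank, and for every definable function $f:A\to B$ between interpretable sets, \begin{itemize} \item for each $n$ the set $\{b\in B : \mathrm{rk}(f^{-1}(b))=n\}$ is definable; \item if $f$ is surjective and all its fibres have rank $n$, then $\mathrm{rk}(A)=\mathrm{rk}(B)+n$; \item there is an $m$ such that every finite fibre of $f$ has at most $m$ elements. \end{itemize} A subgroup $K\le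 G$ (definable or not) is \emph{connected} if every definable subgroup $D\le G$ such that $D\cap K$ has finite index in $K$ contains $K$; for definable $K$, in particular for $K=G$, this means that $K$ has no proper definable subgroup of finite index. A definable subset of $G$ is \emph{generic} if its rank is $\mathrm{rk}(G)$. That, \emph{generically}, elements of $G$ have a property means that at least one of the following holds: \begin{itemize} \item $G$ has a definable generic subset all of whose elements have the property; or \item for some infinite cardinal $\kappa$ the structure $G$ is $\kappa$-saturated (over any set of fewer than $\kappa$ parameters, every family of definable subsets of $G$ with the finite intersection property has a common point), and there is a set $A\subseteq G$ with $|A|<\kappa$ such that every realization in $G$ of the generic type over $A$ (every $g\in G$ lying in no non-generic $A$-definable subset of $G$) has the property. \end{itemize} -/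

import Mathlib

open Set FirstOrder

namespace RankedGroup

/-! Definability in this file always means first-order definability with parameters. -/

section Rank

/-- `RankGE D n X` says that `X` has rank at least `n`, where `D` is the predicate that singles out
the definable subsets of the ambient type: the rank is at least `0` when `X` is nonempty, and at
least `n + 1` when `X` contains infinitely many pairwise disjoint definable subsets of rank at
least `n`. -/
def RankGE {α : Type*} (D : Set α → Prop) : ℕ → Set α → Prop
  | 0, X => X.Nonempty
  | n + 1, X => ∃ Y : ℕ → Set α,
      (∀ i, D (Y i) ∧ Y i ⊆ X ∧ RankGE D n (Y i)) ∧ ∀ i j, i ≠ j → Disjoint (Y i) (Y j)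

/-- The set `X` has rank exactly `n`. -/
def HasRank {α : Type*} (D : Set α → Prop) (X : Set α) (n : ℕ) : Prop :=
  RankGE D n X ∧ ¬ RankGE D (n + 1) X

end Rank

section Interpretable

/-- A sort of imaginaries of the structure `M`: the quotient of a finite Cartesian power of `M` by
a definable equivalence relation. The sets interpretable in `M` are the definable subsets of such
sorts. -/
structure ImaginarySort (L : Language) (M : Type*) [L.Structure M] where
  arity : ℕ
  rel : Setoid (Fin arity → M)
  definable_rel : (univ : Set M).Definable L
    {v : Fin arity ⊕ Fin arity → M | rel (v ∘ Sum.inl) (v ∘ Sum.inr)}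

namespace ImaginarySort

variable {L : Language} {M : Type*} [L.Structure M]

/-- The elements of a sort of imaginaries. -/
def Elem (S : ImaginarySort L M) : Type _ := Quotient S.rel

/-- The class of a tuple. -/
def cls (S : ImaginarySort L M) (x : Fin S.arity → M) : S.Elem := Quotient.mk S.rel x

/-- A set of imaginaries is definable when the set of the tuples that represent its elements is. -/
def IsDefinable (S : ImaginarySort L M) (X : Set S.Elem) : Prop :=
  (univ : Set M).Definable L {x : Fin S.arity → M | S.cls x ∈ X}

/-- `f` restricts to a definable function from the interpretable set `A` to the interpretable set
`B`. -/
structure IsDefinableMap (S T : ImaginarySort L M) (A : Set S.Elem) (B : Set T.Elem)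
    (f : S.Elem → T.Elem) : Prop where
  definable_source : S.IsDefinable A
  definable_target : T.IsDefinable B
  mapsTo : MapsTo f A B
  definable_graph : (univ : Set M).Definable L {v : Fin S.arity ⊕ Fin T.arity → M |
    S.cls (v ∘ Sum.inl) ∈ A ∧ f (S.cls (v ∘ Sum.inl)) = T.cls (v ∘ Sum.inr)}

end ImaginarySort

/-- Ranked structures (the Borovik-Poizat axioms): the rank of every nonempty interpretable set is
finite, and it is definable and additive in definable families; moreover there are uniform bounds
on the sizes of the finite sets in a definable family. The remaining axiom, that a set has rank at
least `n + 1` exactly when it contains infinitely many pairwise disjoint definable subsets of rank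
at least `n`, is the definition of the rank. -/
structure IsRanked (L : Language) (M : Type*) [L.Structure M] : Prop where
  finite_rank : ∀ (S : ImaginarySort L M) (X : Set S.Elem), S.IsDefinable X → X.Nonempty →
    ∃ n, HasRank S.IsDefinable X n
  definability : ∀ (S T : ImaginarySort L M) (A : Set S.Elem) (B : Set T.Elem)
    (f : S.Elem → T.Elem), S.IsDefinableMap T A B f → ∀ n : ℕ,
      T.IsDefinable {b | b ∈ B ∧ HasRank S.IsDefinable {a | a ∈ A ∧ f a = b} n}
  additivity : ∀ (S T : ImaginarySort L M) (A : Set S.Elem) (B : Set T.Elem)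
    (f : S.Elem → T.Elem), S.IsDefinableMap T A B f → SurjOn f A B → ∀ m n : ℕ,
      HasRank T.IsDefinable B m →
      (∀ b ∈ B, HasRank S.IsDefinable {a | a ∈ A ∧ f a = b} n) →
      HasRank S.IsDefinable A (m + n)
  finite_bound : ∀ (S T : ImaginarySort L M) (A : Set S.Elem) (B : Set T.Elem)
    (f : S.Elem → T.Elem), S.IsDefinableMap T A B f →
      ∃ m : ℕ, ∀ b ∈ B, {a | a ∈ A ∧ f a = b}.Finite → {a | a ∈ A ∧ f a = b}.ncard ≤ m

end Interpretable

section Groups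

/-- Groups of finite Morley rank: a group with a (possibly richer) first-order structure in which
the multiplication is definable and which is ranked. -/
structure IsGroupOfFiniteMorleyRank (L : Language) (G : Type*) [Group G] [L.Structure G] :
    Prop where
  definable_mul : (univ : Set G).Definable L {v : Fin 3 → G | v 0 * v 1 = v 2}
  ranked : IsRanked L G

variable (L : Language) {G : Type*} [Group G] [L.Structure G]

/-- A definable subset of `G`. -/
def IsDefinable (X : Set G) : Prop := (univ : Set G).Definable₁ L X

/-- A subgroup `K` (definable or not) is connected when it has no proper subgroup of finite index
of the form `D ∩ K` with `D` definable. For a definable `K` this says that `K` has no proper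
definable subgroup of finite index. -/
def IsConnected (K : Subgroup G) : Prop :=
  ∀ D : Subgroup G, IsDefinable L (D : Set G) → D.relIndex K ≠ 0 → K ≤ D

/-- A definable subset of `G` is generic when it has the same rank as `G`. -/
def IsGeneric (X : Set G) : Prop :=
  IsDefinable L X ∧ ∃ n, HasRank (IsDefinable L) X n ∧ HasRank (IsDefinable L) (univ : Set G) n

/-- The union of the `G`-conjugates of `X`. -/
def conjUnion (X : Set G) : Set G := {x | ∃ g : G, ∃ h ∈ X, x = g⁻¹ * h * g}

/-- A definable set is generous when the union of its conjugates (which is definable, see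
`isDefinable_conjUnion`) is generic. -/
def IsGenerous (X : Set G) : Prop := IsGeneric L (conjUnion X)

/-- The element `g` realizes a generic type over the set `A` of parameters: it belongs to no
nongeneric subset of `G` definable over `A`. -/
def IsGenericOver (A : Set G) (g : G) : Prop :=
  ∀ X : Set G, A.Definable₁ L X → ¬ IsGeneric L X → g ∉ X

/-- `G` is `κ`-saturated: over fewer than `κ` parameters, every family of definable subsets
with the finite intersection property has a common point. -/
def IsSaturated (G : Type*) [L.Structure G] (κ : Cardinal) : Prop :=
  ∀ A : Set G, Cardinal.mk A < κ → ∀ F : Set (Set G), (∀ X ∈ F, A.Definable₁ L X) →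
    (∀ F₀ : Set (Set G), F₀ ⊆ F → F₀.Finite → (⋂₀ F₀).Nonempty) → (⋂₀ F).Nonempty

/-- The element `g` belongs to a connected nilpotent subgroup. -/
def InConnectedNilpotent (g : G) : Prop :=
  ∃ Q : Subgroup G, IsConnected L Q ∧ Group.IsNilpotent Q ∧ g ∈ Q

/-- Generically, elements of `G` satisfy `P`: either all the elements of some definable generic
subset satisfy `P`, or `G` is saturated and all the realizations in `G` of the generic type over
some small set of parameters satisfy `P`. -/
def Generically (P : G → Prop) : Prop :=
  (∃ X : Set G, IsGeneric L X ∧ ∀ g ∈ X, P g) ∨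
  (∃ κ : Cardinal, Cardinal.aleph0 ≤ κ ∧ IsSaturated L G κ ∧
    ∃ A : Set G, Cardinal.mk A < κ ∧ ∀ g : G, IsGenericOver L A g → P g)

theorem isDefinable_conjUnion
    (hmul : (univ : Set G).Definable L {v : Fin 3 → G | v 0 * v 1 = v 2})
    {X : Set G} (hX : IsDefinable L X) : IsDefinable L (conjUnion X) := by
  -- coordinates: 0 is x, 1 is g, 2 is h, 3 is y = g * x = h * g
  have h1 := hmul.preimage_comp (![1, 0, 3] : Fin 3 → Fin 4)
  have h2 := hmul.preimage_comp (![2, 1, 3] : Fin 3 → Fin 4)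
  have h3 : (univ : Set G).Definable L {v : Fin 4 → G | v 2 ∈ X} :=
    Definable.preimage_comp (![2] : Fin 1 → Fin 4) hX
  have h := ((h1.inter h2).inter h3).image_comp (![0] : Fin 1 → Fin 4)
  unfold IsDefinable Definable₁
  convert h using 1
  ext v
  simp only [conjUnion, mem_ofPred_eq, mem_image, mem_inter_iff, mem_preimage, Function.comp_apply]
  constructor
  · rintro ⟨g, k, hk, hv⟩
    refine ⟨![v 0, g, k, k * g], ⟨⟨?_, ?_⟩, ?_⟩, ?_⟩
    · simp [hv, mul_assoc]
    · simp
    · simpa using hk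
    · funext i
      fin_cases i
      rfl
  · rintro ⟨u, ⟨⟨hu1, hu2⟩, hu3⟩, rfl⟩
    refine ⟨u 1, u 2, hu3, ?_⟩
    have e : u 1 * u 0 = u 2 * u 1 := by
      have e1 : u 1 * u 0 = u 3 := by simpa using hu1
      have e2 : u 2 * u 1 = u 3 := by simpa using hu2
      rw [e1, e2]
    simp [mul_assoc, ← e]

end Groups

end RankedGroup

set_option linter.unusedSectionVars false

namespace RankedGroup

/-! ### Rank for an arbitrary notion of definable set -/

section AbstractRank

variable {α β ι : Type*} {D : Set α → Prop} {n m : ℕ} {X Y Z : Set α}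

/-! Let `n` be the rank of `G` and `r` that of `H`, and suppose `w * H` is generous. The relation
"`g` conjugates `y` into `w * H`" has rank at most `n + r`, so for generic `y` the set of such `g`
is nonempty of rank at most `r` (`exists_rankGE_conjugators`). Generic sets of a connected group
meet (`inter_nonempty_of_rankGE`), and in the saturated case a generic set contains realizations of
the generic type (`exists_isGenericOver_mem`). Either way some such `y` lies in a connected
nilpotent subgroup (`Generically.exists_mem`). After conjugation there is `x ∈ w * H` inside a
connected nilpotent `Q`, while `E = {v | v * x * v⁻¹ ∈ w * H}` has rank at most `r`.

Since `w` normalizes `H`, the set `E` is a union of cosets `H * v`, and rank `r` leaves room for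
only finitely many of them. Every subgroup `V` of `Q` whose commutators with `x` lie in `H` is
contained in `E`, so `H ∩ V` has finite index in `V` (`relIndex_ne_zero_of_subset`).

This is propagated along the upper central series of `Q` (`index_ne_zero_of_isNilpotent`). If `H`
has finite index in the `i`-th term, so does the core `N` of `H ∩ Q` in `Q`, by the descending chain
condition (`relIndex_normalCore_ne_zero`). Commutators of `x` with the next term fall into the
`i`-th one, so a finite-index subgroup of the next term centralizes `x` modulo `N`; this subgroup
serves as `V`. Hence `H ∩ Q` has finite index in `Q`, connectedness gives `Q ≤ H`, and `x ∈ H`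
contradicts `w ∉ H`. -/

theorem RankGE.mono (h : RankGE D n X) (hXY : X ⊆ Y) : RankGE D n Y := by
  cases n with
  | zero => exact Set.Nonempty.mono hXY h
  | succ n =>
    obtain ⟨W, hW, hd⟩ := h
    exact ⟨W, fun i => ⟨(hW i).1, (hW i).2.1.trans hXY, (hW i).2.2⟩, hd⟩

theorem RankGE.of_succ (h : RankGE D (n + 1) X) : RankGE D n X := by
  obtain ⟨W, hW, -⟩ := h
  exact (hW 0).2.2.mono (hW 0).2.1

theorem RankGE.of_le (h : RankGE D n X) (hmn : m ≤ n) : RankGE D m X := by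
  induction hmn with
  | refl => exact h
  | step _ ih => exact ih h.of_succ

theorem RankGE.nonempty (h : RankGE D n X) : X.Nonempty :=
  h.of_le (Nat.zero_le n)

theorem HasRank.eq_of_hasRank (h : HasRank D X n) (h' : HasRank D X m) : n = m := by
  by_contra hne
  rcases Nat.lt_or_gt_of_ne hne with hlt | hlt
  · exact h.2 (h'.1.of_le hlt)
  · exact h'.2 (h.1.of_le hlt)

theorem HasRank.le_of_rankGE (h : HasRank D X n) (h' : RankGE D m X) : m ≤ n := by
  by_contra hlt
  exact h.2 (h'.of_le (by omega))

theorem RankGE.succ_of_infinite [Infinite ι] (W : ι → Set α) (hD : ∀ i, D (W i))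
    (hX : ∀ i, W i ⊆ X) (hr : ∀ i, RankGE D n (W i)) (hd : ∀ i j, i ≠ j → Disjoint (W i) (W j)) :
    RankGE D (n + 1) X := by
  let e := Infinite.natEmbedding ι
  exact ⟨fun i => W (e i), fun i => ⟨hD _, hX _, hr _⟩,
    fun i j hij => hd _ _ fun h => hij (e.injective h)⟩

/-- Induction on the rank with the infinite pigeonhole principle: of infinitely many disjoint pieces
of `Z`, infinitely many keep their rank on the same side. -/
theorem RankGE.or_of_subset_union (hinter : ∀ X Y, D X → D Y → D (X ∩ Y))
    (hX : D X) (hY : D Y) (h : RankGE D n Z) (hZ : Z ⊆ X ∪ Y) : RankGE D n X ∨ RankGE D n Y := by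
  induction n generalizing X Y Z with
  | zero =>
    obtain ⟨z, hz⟩ := h
    exact (hZ hz).imp (fun hz => ⟨z, hz⟩) (fun hz => ⟨z, hz⟩)
  | succ n ih =>
    obtain ⟨W, hW, hd⟩ := h
    have key : ∀ i, RankGE D n (W i ∩ X) ∨ RankGE D n (W i ∩ Y) := fun i => by
      refine ih (hinter _ _ (hW i).1 hX) (hinter _ _ (hW i).1 hY) (hW i).2.2 ?_
      rw [← inter_union_distrib_left]
      exact subset_inter Subset.rfl ((hW i).2.1.trans hZ)
    have hunion : {i | RankGE D n (W i ∩ X)} ∪ {i | RankGE D n (W i ∩ Y)} = univ :=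
      eq_univ_of_forall key
    have hinf := hunion ▸ (infinite_univ : (univ : Set ℕ).Infinite)
    rcases infinite_union.1 hinf with hinf | hinf
    · left
      have := hinf.to_subtype
      exact RankGE.succ_of_infinite (fun i : {i | RankGE D n (W i ∩ X)} => W i ∩ X)
        (fun i => hinter _ _ (hW i).1 hX) (fun i => inter_subset_right) (fun i => i.2)
        fun i j hij => (hd i j fun h => hij (Subtype.ext h)).mono inter_subset_left
          inter_subset_left
    · right
      have := hinf.to_subtype
      exact RankGE.succ_of_infinite (fun i : {i | RankGE D n (W i ∩ Y)} => W i ∩ Y)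
        (fun i => hinter _ _ (hW i).1 hY) (fun i => inter_subset_right) (fun i => i.2)
        fun i j hij => (hd i j fun h => hij (Subtype.ext h)).mono inter_subset_left
          inter_subset_left

theorem definable_biUnion_lt (hempty : D ∅) (hunion : ∀ X Y, D X → D Y → D (X ∪ Y)) (k : ℕ)
    (W : ℕ → Set α) (hW : ∀ i, D (W i)) : D (⋃ i < k, W i) := by
  induction k with
  | zero => simpa using hempty
  | succ k ih =>
    rw [biUnion_lt_succ]
    exact hunion _ _ ih (hW k)

theorem RankGE.exists_of_subset_biUnion_lt (hempty : D ∅)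
    (hinter : ∀ X Y, D X → D Y → D (X ∩ Y)) (hunion : ∀ X Y, D X → D Y → D (X ∪ Y)) (k : ℕ)
    (W : ℕ → Set α) (hW : ∀ i, D (W i)) (h : RankGE D n Z) (hZ : Z ⊆ ⋃ i < k, W i) :
    ∃ i < k, RankGE D n (W i) := by
  induction k generalizing Z with
  | zero =>
    obtain ⟨z, hz⟩ := h.nonempty
    simpa using hZ hz
  | succ k ih =>
    rw [biUnion_lt_succ] at hZ
    rcases h.or_of_subset_union hinter (definable_biUnion_lt hempty hunion k W hW) (hW k) hZ
      with h | h
    · obtain ⟨i, hi, hr⟩ := ih h Subset.rfl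
      exact ⟨i, by omega, hr⟩
    · exact ⟨k, by omega, h⟩

/-- The single transport principle behind the passage to imaginaries, to fibres of relations, and to
translates and conjugates. -/
theorem rankGE_image_iff {E : Set β → Prop} {e : α → β} (he : Function.Injective e)
    (himage : ∀ X, D X → E (e '' X)) (hpreimage : ∀ Z, E Z → D (e ⁻¹' Z)) :
    RankGE E n (e '' X) ↔ RankGE D n X := by
  induction n generalizing X with
  | zero => exact image_nonempty
  | succ n ih =>
    constructor
    · rintro ⟨W, hW, hd⟩
      have hWe : ∀ i, e '' (e ⁻¹' W i) = W i := fun i =>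
        image_preimage_eq_of_subset ((hW i).2.1.trans (image_subset_range e X))
      refine ⟨fun i => e ⁻¹' W i, fun i => ⟨hpreimage _ (hW i).1, ?_, ?_⟩, fun i j hij =>
        (hd i j hij).preimage e⟩
      · rw [← image_subset_image_iff he, hWe]
        exact (hW i).2.1
      · rw [← ih, hWe]
        exact (hW i).2.2
    · rintro ⟨W, hW, hd⟩
      exact ⟨fun i => e '' W i, fun i => ⟨himage _ (hW i).1, image_mono (hW i).2.1,
        ih.2 (hW i).2.2⟩, fun i j hij => (disjoint_image_iff he).2 (hd i j hij)⟩

theorem hasRank_image_iff {E : Set β → Prop} {e : α → β} (he : Function.Injective e)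
    (himage : ∀ X, D X → E (e '' X)) (hpreimage : ∀ Z, E Z → D (e ⁻¹' Z)) :
    HasRank E (e '' X) n ↔ HasRank D X n :=
  and_congr (rankGE_image_iff he himage hpreimage)
    (not_congr (rankGE_image_iff he himage hpreimage))

end AbstractRank

/-! ### Definable subsets of `G` and of `G × G` -/

section Definability

variable {L : Language} {G : Type*} [Group G] [L.Structure G] {X Y : Set G} {R S : Set (G × G)}

theorem IsDefinable.inter (hX : IsDefinable L X) (hY : IsDefinable L Y) : IsDefinable L (X ∩ Y) :=
  Definable.inter hX hY

theorem IsDefinable.union (hX : IsDefinable L X) (hY : IsDefinable L Y) : IsDefinable L (X ∪ Y) :=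
  Definable.union hX hY

theorem IsDefinable.sdiff (hX : IsDefinable L X) (hY : IsDefinable L Y) : IsDefinable L (X \ Y) :=
  Definable.sdiff hX hY

theorem IsDefinable.compl (hX : IsDefinable L X) : IsDefinable L Xᶜ :=
  Definable.compl hX

theorem isDefinable_univ : IsDefinable L (univ : Set G) := definable_univ

theorem isDefinable_empty : IsDefinable L (∅ : Set G) := definable_empty

/-- A definable binary relation on `G`. -/
abbrev IsDefinableRel (L : Language) {G : Type*} [L.Structure G] (R : Set (G × G)) : Prop :=
  (univ : Set G).Definable₂ L R

theorem isDefinableRel_inter (hR : IsDefinableRel L R) (hS : IsDefinableRel L S) :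
    IsDefinableRel L (R ∩ S) :=
  Definable.inter hR hS

theorem isDefinableRel_union (hR : IsDefinableRel L R) (hS : IsDefinableRel L S) :
    IsDefinableRel L (R ∪ S) :=
  Definable.union hR hS

theorem isDefinableRel_empty : IsDefinableRel L (∅ : Set (G × G)) := definable_empty

theorem IsDefinable.fst (hX : IsDefinable L X) : IsDefinableRel L {p : G × G | p.1 ∈ X} :=
  Definable.preimage_comp (![0] : Fin 1 → Fin 2) hX

theorem IsDefinable.snd (hX : IsDefinable L X) : IsDefinableRel L {p : G × G | p.2 ∈ X} :=
  Definable.preimage_comp (![1] : Fin 1 → Fin 2) hX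

theorem isDefinableRel_swap (hR : IsDefinableRel L R) :
    IsDefinableRel L {p : G × G | (p.2, p.1) ∈ R} :=
  Definable.preimage_comp (![1, 0] : Fin 2 → Fin 2) hR

theorem isDefinable_image_fst (hR : IsDefinableRel L R) :
    IsDefinable L {x : G | ∃ y, (x, y) ∈ R} := by
  have h := Definable.image_comp hR (![0] : Fin 1 → Fin 2)
  unfold IsDefinable Definable₁
  convert h using 1
  ext v
  simp only [mem_ofPred_eq, mem_image]
  constructor
  · rintro ⟨y, hy⟩
    refine ⟨![v 0, y], by simpa using hy, ?_⟩
    funext i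
    fin_cases i
    rfl
  · rintro ⟨u, hu, rfl⟩
    exact ⟨u 1, hu⟩

theorem isDefinable_singleton (a : G) : IsDefinable L ({a} : Set G) :=
  Definable.singleton_of_mem L (mem_univ a)

theorem isDefinable_fiber (hR : IsDefinableRel L R) (x : G) :
    IsDefinable L {y : G | (x, y) ∈ R} := by
  have h := isDefinable_image_fst (isDefinableRel_inter (isDefinableRel_swap hR)
    (isDefinable_singleton (L := L) x).snd)
  convert h using 1
  ext y
  simp

theorem isDefinableRel_mk_image (x : G) (hX : IsDefinable L X) :
    IsDefinableRel L (Prod.mk x '' X) := by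
  have h := isDefinableRel_inter (isDefinable_singleton (L := L) x).fst hX.snd
  convert h using 1
  ext ⟨a, b⟩
  simp only [mem_image, Prod.mk.injEq, mem_inter_iff, mem_ofPred_eq, mem_singleton_iff]
  constructor
  · rintro ⟨c, hc, rfl, rfl⟩
    exact ⟨rfl, hc⟩
  · rintro ⟨rfl, hb⟩
    exact ⟨b, hb, rfl, rfl⟩

end Definability

/-! ### `G` and `G × G` as sorts of imaginaries, where the rank axioms apply -/

section Sorts

variable (L : Language) (G : Type*) [Group G] [L.Structure G]

theorem definable_eq_coordinates {ι : Type*} (i j : ι) :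
    (univ : Set G).Definable L {v : ι → G | v i = v j} :=
  Definable.preimage_comp (![i, j] : Fin 2 → ι) (Definable.diagonal L (univ : Set G))

/-- The Cartesian power of the home sort, as a sort of imaginaries. -/
def powerSort (k : ℕ) : ImaginarySort L G where
  arity := k
  rel := ⊥
  definable_rel := by
    have h := definable_biInter_finset (fun i : Fin k =>
      definable_eq_coordinates L G (Sum.inl i : Fin k ⊕ Fin k) (Sum.inr i)) Finset.univ
    convert h using 1
    ext v
    simp only [Setoid.bot_def, mem_ofPred_eq, Finset.mem_univ, iInter_true, mem_iInter]
    exact funext_iff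

variable {L G}

/-- The tuples of elements of `G` as imaginaries. -/
def tupleToSort (k : ℕ) (v : Fin k → G) : (powerSort L G k).Elem := (powerSort L G k).cls v

theorem tupleToSort_bijective (k : ℕ) :
    Function.Bijective (tupleToSort k : (Fin k → G) → (powerSort L G k).Elem) :=
  ⟨fun _ _ h => Quotient.exact h, Quotient.mk_surjective⟩

theorem powerSort_isDefinable_iff {k : ℕ} {Z : Set (powerSort L G k).Elem} :
    (powerSort L G k).IsDefinable Z ↔
      (univ : Set G).Definable L {v : Fin k → G | tupleToSort k v ∈ Z} :=
  Iff.rfl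

/-- The elements of `G` as imaginaries. -/
def toSort (a : G) : (powerSort L G 1).Elem := tupleToSort 1 (fun _ => a)

/-- The pairs of elements of `G` as imaginaries. -/
def pairToSort (p : G × G) : (powerSort L G 2).Elem := tupleToSort 2 ![p.1, p.2]

theorem tupleToSort_one (v : Fin 1 → G) :
    tupleToSort 1 v = (toSort (v 0) : (powerSort L G 1).Elem) := by
  unfold toSort
  congr 1
  funext i
  rw [Subsingleton.elim i 0]

theorem tupleToSort_two (v : Fin 2 → G) :
    tupleToSort 2 v = (pairToSort (v 0, v 1) : (powerSort L G 2).Elem) := by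
  unfold pairToSort
  congr 1
  funext i
  fin_cases i <;> rfl

theorem toSort_bijective : Function.Bijective (toSort : G → (powerSort L G 1).Elem) := by
  constructor
  · intro a b h
    exact congrFun ((tupleToSort_bijective 1).1 h) 0
  · intro s
    obtain ⟨v, rfl⟩ := (tupleToSort_bijective 1).2 s
    exact ⟨v 0, (tupleToSort_one v).symm⟩

theorem pairToSort_bijective :
    Function.Bijective (pairToSort : G × G → (powerSort L G 2).Elem) := by
  constructor
  · intro p q h
    have h := (tupleToSort_bijective 2).1 h
    exact Prod.ext (congrFun h 0) (congrFun h 1)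
  · intro s
    obtain ⟨v, rfl⟩ := (tupleToSort_bijective 2).2 s
    exact ⟨(v 0, v 1), (tupleToSort_two v).symm⟩

theorem isDefinable_preimage_toSort {Z : Set (powerSort L G 1).Elem} :
    IsDefinable L (toSort ⁻¹' Z) ↔ (powerSort L G 1).IsDefinable Z := by
  simp only [powerSort_isDefinable_iff, tupleToSort_one]
  rfl

theorem isDefinableRel_preimage_pairToSort {Z : Set (powerSort L G 2).Elem} :
    IsDefinableRel L (pairToSort ⁻¹' Z) ↔ (powerSort L G 2).IsDefinable Z := by
  simp only [powerSort_isDefinable_iff, tupleToSort_two]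
  rfl

theorem isDefinable_image_toSort {X : Set G} :
    (powerSort L G 1).IsDefinable (toSort '' X) ↔ IsDefinable L X := by
  rw [← isDefinable_preimage_toSort, preimage_image_eq _ toSort_bijective.1]

theorem isDefinable_image_pairToSort {R : Set (G × G)} :
    (powerSort L G 2).IsDefinable (pairToSort '' R) ↔ IsDefinableRel L R := by
  rw [← isDefinableRel_preimage_pairToSort, preimage_image_eq _ pairToSort_bijective.1]

theorem hasRank_image_toSort {X : Set G} {n : ℕ} :
    HasRank (powerSort L G 1).IsDefinable (toSort '' X) n ↔ HasRank (IsDefinable L) X n :=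
  hasRank_image_iff toSort_bijective.1 (fun _ => isDefinable_image_toSort.2)
    (fun _ => isDefinable_preimage_toSort.2)

theorem hasRank_image_pairToSort {R : Set (G × G)} {n : ℕ} :
    HasRank (powerSort L G 2).IsDefinable (pairToSort '' R) n ↔
      HasRank (IsDefinableRel L) R n :=
  hasRank_image_iff pairToSort_bijective.1 (fun _ => isDefinable_image_pairToSort.2)
    (fun _ => isDefinableRel_preimage_pairToSort.2)

variable (L G) in
/-- The first projection between sorts of imaginaries. -/
noncomputable def sortFst (s : (powerSort L G 2).Elem) : (powerSort L G 1).Elem :=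
  toSort ((Equiv.ofBijective _ (pairToSort_bijective (L := L) (G := G))).symm s).1

@[simp]
theorem sortFst_pairToSort (p : G × G) : sortFst L G (pairToSort p) = toSort p.1 := by
  unfold sortFst
  rw [show pairToSort p = Equiv.ofBijective _ (pairToSort_bijective (L := L) (G := G)) p from rfl,
    Equiv.symm_apply_apply]

theorem isDefinableMap_sortFst {R : Set (G × G)} (hR : IsDefinableRel L R) {X : Set G}
    (hX : IsDefinable L X) (hRX : ∀ p ∈ R, p.1 ∈ X) :
    (powerSort L G 2).IsDefinableMap (powerSort L G 1) (pairToSort '' R) (toSort '' X)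
      (sortFst L G) where
  definable_source := isDefinable_image_pairToSort.2 hR
  definable_target := isDefinable_image_toSort.2 hX
  mapsTo := by
    rintro _ ⟨p, hp, rfl⟩
    exact ⟨p.1, hRX p hp, (sortFst_pairToSort p).symm⟩
  definable_graph := by
    have h1 : (univ : Set G).Definable L
        {v : Fin 2 ⊕ Fin 1 → G | (v (Sum.inl 0), v (Sum.inl 1)) ∈ R} :=
      Definable.preimage_comp (Sum.inl : Fin 2 → Fin 2 ⊕ Fin 1) hR
    have h2 := definable_eq_coordinates L G (Sum.inl 0 : Fin 2 ⊕ Fin 1) (Sum.inr 0)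
    refine (congrArg _ ?_).mp (h1.inter h2)
    ext v
    change _ ↔ tupleToSort 2 (fun i => v (Sum.inl i)) ∈ pairToSort '' R ∧
      sortFst L G (tupleToSort 2 (fun i => v (Sum.inl i))) =
        tupleToSort 1 (fun i => v (Sum.inr i))
    rw [tupleToSort_one, tupleToSort_two, sortFst_pairToSort,
      pairToSort_bijective.1.mem_set_image, toSort_bijective.1.eq_iff]
    rfl

theorem sortFst_fiber (R : Set (G × G)) (x : G) :
    {a | a ∈ pairToSort '' R ∧ sortFst L G a = toSort x} =
      pairToSort '' (Prod.mk x '' {y | (x, y) ∈ R}) := by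
  ext a
  constructor
  · rintro ⟨⟨⟨x', y⟩, hp, rfl⟩, h⟩
    rw [sortFst_pairToSort, toSort_bijective.1.eq_iff] at h
    subst h
    exact ⟨_, ⟨y, hp, rfl⟩, rfl⟩
  · rintro ⟨_, ⟨y, hy, rfl⟩, rfl⟩
    exact ⟨⟨_, hy, rfl⟩, sortFst_pairToSort _⟩

theorem rankGE_mk_image {X : Set G} (x : G) {n : ℕ} :
    RankGE (IsDefinableRel L) n (Prod.mk x '' X) ↔ RankGE (IsDefinable L) n X :=
  rankGE_image_iff (Prod.mk_right_injective x) (fun _ => isDefinableRel_mk_image x)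
    (fun _ h => isDefinable_fiber h x)

theorem hasRank_sortFst_fiber (R : Set (G × G)) (x : G) (n : ℕ) :
    HasRank (powerSort L G 2).IsDefinable
      {a | a ∈ pairToSort '' R ∧ sortFst L G a = toSort x} n ↔
      HasRank (IsDefinable L) {y | (x, y) ∈ R} n := by
  rw [sortFst_fiber, hasRank_image_pairToSort]
  exact and_congr (rankGE_mk_image x) (not_congr (rankGE_mk_image x))

end Sorts

/-! ### Rank of a binary relation in terms of its projection and fibres -/

namespace IsRanked

variable {L : Language} {G : Type*} [Group G] [L.Structure G] {X : Set G} {R : Set (G × G)}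
  {m n : ℕ}

theorem exists_hasRank (hG : IsRanked L G) (hX : IsDefinable L X) (hne : X.Nonempty) :
    ∃ n, HasRank (IsDefinable L) X n := by
  obtain ⟨n, hn⟩ := hG.finite_rank _ _ (isDefinable_image_toSort.2 hX) (hne.image _)
  exact ⟨n, hasRank_image_toSort.1 hn⟩

theorem exists_hasRank_rel (hG : IsRanked L G) (hR : IsDefinableRel L R) (hne : R.Nonempty) :
    ∃ n, HasRank (IsDefinableRel L) R n := by
  obtain ⟨n, hn⟩ := hG.finite_rank _ _ (isDefinable_image_pairToSort.2 hR) (hne.image _)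
  exact ⟨n, hasRank_image_pairToSort.1 hn⟩

theorem isDefinable_hasRank_fiber (hG : IsRanked L G) (hR : IsDefinableRel L R) (n : ℕ) :
    IsDefinable L {x | HasRank (IsDefinable L) {y | (x, y) ∈ R} n} := by
  have h := hG.definability _ _ _ _ _
    (isDefinableMap_sortFst hR isDefinable_univ fun _ _ => mem_univ _) n
  rw [← isDefinable_preimage_toSort] at h
  convert h using 1
  ext x
  have hx : toSort x ∈ toSort (L := L) '' (univ : Set G) := ⟨x, mem_univ x, rfl⟩
  simp only [mem_preimage, mem_ofPred_eq, hx, true_and]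
  exact (hasRank_sortFst_fiber R x n).symm

theorem hasRank_rel (hG : IsRanked L G) (hR : IsDefinableRel L R)
    (hm : HasRank (IsDefinable L) {x | ∃ y, (x, y) ∈ R} m)
    (hn : ∀ x y, (x, y) ∈ R → HasRank (IsDefinable L) {y | (x, y) ∈ R} n) :
    HasRank (IsDefinableRel L) R (m + n) := by
  have h := hG.additivity _ _ _ _ _
    (isDefinableMap_sortFst hR (isDefinable_image_fst hR) fun p hp => ⟨p.2, hp⟩) ?_ m n
    (hasRank_image_toSort.2 hm) ?_
  · exact hasRank_image_pairToSort.1 h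
  · rintro _ ⟨x, ⟨y, hy⟩, rfl⟩
    exact ⟨_, ⟨_, hy, rfl⟩, sortFst_pairToSort _⟩
  · rintro _ ⟨x, ⟨y, hy⟩, rfl⟩
    exact (hasRank_sortFst_fiber R x n).2 (hn x y hy)

theorem rankGE_of_fiber {x : G} (h : RankGE (IsDefinable L) n {y | (x, y) ∈ R}) :
    RankGE (IsDefinableRel L) n R := by
  refine ((rankGE_mk_image x).2 h).mono ?_
  rintro _ ⟨y, hy, rfl⟩
  exact hy

theorem isDefinableRel_hasRank_fiber (hG : IsRanked L G) (hR : IsDefinableRel L R) (i : ℕ) :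
    IsDefinableRel L {p | p ∈ R ∧ HasRank (IsDefinable L) {y | (p.1, y) ∈ R} i} :=
  isDefinableRel_inter hR (hG.isDefinable_hasRank_fiber hR i).fst

/-- Additivity of the rank for the part of a definable relation with fibres of a given rank. -/
theorem exists_hasRank_of_hasRank_fiber (hG : IsRanked L G) (hR : IsDefinableRel L R) (i : ℕ)
    (hne : {p | p ∈ R ∧ HasRank (IsDefinable L) {y | (p.1, y) ∈ R} i}.Nonempty) :
    ∃ k, HasRank (IsDefinable L)
        {x | ∃ y, (x, y) ∈ R ∧ HasRank (IsDefinable L) {y | (x, y) ∈ R} i} k ∧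
      HasRank (IsDefinableRel L) {p | p ∈ R ∧ HasRank (IsDefinable L) {y | (p.1, y) ∈ R} i}
        (k + i) := by
  have hRi := hG.isDefinableRel_hasRank_fiber hR i
  obtain ⟨⟨x, y⟩, hp⟩ := hne
  obtain ⟨k, hk⟩ := hG.exists_hasRank (isDefinable_image_fst hRi) ⟨x, y, hp⟩
  refine ⟨k, hk, hG.hasRank_rel hRi hk fun x y hxy => ?_⟩
  convert hxy.2 using 1
  ext z
  exact and_iff_left hxy.2

/-- A definable relation whose projection has rank at most `m` and whose fibres have rank at
most `n` has rank at most `m + n`. -/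
theorem not_rankGE_rel (hG : IsRanked L G) (hR : IsDefinableRel L R)
    (hm : ¬ RankGE (IsDefinable L) (m + 1) {x | ∃ y, (x, y) ∈ R})
    (hn : ∀ x, ¬ RankGE (IsDefinable L) (n + 1) {y | (x, y) ∈ R}) :
    ¬ RankGE (IsDefinableRel L) (m + n + 1) R := by
  intro h
  -- `R` is cut into the finitely many parts over which the fibre rank is a constant `i ≤ n`; one
  -- part carries the full rank, and additivity applies to it.
  obtain ⟨i, hi, hr⟩ := h.exists_of_subset_biUnion_lt isDefinableRel_empty
    (fun _ _ => isDefinableRel_inter) (fun _ _ => isDefinableRel_union) (n + 1) _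
    (hG.isDefinableRel_hasRank_fiber hR) (by
      rintro ⟨x, y⟩ hp
      obtain ⟨i, hi⟩ := hG.exists_hasRank (isDefinable_fiber hR x) ⟨y, hp⟩
      refine mem_iUnion₂.2 ⟨i, ?_, hp, hi⟩
      by_contra hlt
      exact hn x (hi.1.of_le (by omega)))
  obtain ⟨k, hk, hki⟩ := hG.exists_hasRank_of_hasRank_fiber hR i hr.nonempty
  have h1 := hki.le_of_rankGE hr
  have h2 : k < m + 1 := by
    by_contra hlt
    refine hm ((hk.1.of_le (by omega)).mono ?_)
    rintro x ⟨y, hy, -⟩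
    exact ⟨y, hy⟩
  omega

/-- A definable relation whose projection has rank at least `m` and whose nonempty fibres have
rank at least `n` has rank at least `m + n`. -/
theorem rankGE_rel (hG : IsRanked L G) (hR : IsDefinableRel L R)
    (hm : RankGE (IsDefinable L) m {x | ∃ y, (x, y) ∈ R})
    (hn : ∀ x y, (x, y) ∈ R → RankGE (IsDefinable L) n {y | (x, y) ∈ R}) :
    RankGE (IsDefinableRel L) (m + n) R := by
  obtain ⟨x₀, y₀, h₀⟩ := hm.nonempty
  obtain ⟨N, hN⟩ := hG.exists_hasRank_rel hR ⟨_, h₀⟩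
  -- Fibre ranks are bounded by the rank `N` of `R`, so the projection is a finite union of parts
  -- with constant fibre rank, one of which has rank at least `m`.
  obtain ⟨i, -, hr⟩ := hm.exists_of_subset_biUnion_lt isDefinable_empty
    (fun _ _ => IsDefinable.inter) (fun _ _ => IsDefinable.union) (N + 1) _
    (fun i => isDefinable_image_fst (hG.isDefinableRel_hasRank_fiber hR i)) (by
      rintro x ⟨y, hp⟩
      obtain ⟨i, hi⟩ := hG.exists_hasRank (isDefinable_fiber hR x) ⟨y, hp⟩
      refine mem_iUnion₂.2 ⟨i, ?_, y, hp, hi⟩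
      exact Nat.lt_succ_of_le (hN.le_of_rankGE (rankGE_of_fiber hi.1)))
  obtain ⟨x, y, hxy, hi⟩ := hr.nonempty
  obtain ⟨k, hk, hki⟩ := hG.exists_hasRank_of_hasRank_fiber hR i ⟨(x, y), hxy, hi⟩
  have h1 := hk.le_of_rankGE hr
  have h2 := hi.le_of_rankGE (hn x y hxy)
  exact (hki.1.mono fun p hp => hp.1).of_le (by omega)

theorem rankGE_swap (R : Set (G × G)) :
    RankGE (IsDefinableRel L) n {p | (p.2, p.1) ∈ R} ↔ RankGE (IsDefinableRel L) n R := by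
  have h : ∀ S : Set (G × G), Prod.swap '' S = {p | (p.2, p.1) ∈ S} := fun S =>
    congrFun image_swap_eq_preimage_swap S
  rw [← h]
  refine rankGE_image_iff Prod.swap_injective (fun S hS => ?_) fun S hS => ?_
  · rw [h]
    exact isDefinableRel_swap hS
  · exact isDefinableRel_swap hS

end IsRanked

/-! ### Definability and rank under translation and conjugation -/

section GroupDefinability

variable {L : Language} {G : Type*} [Group G] [L.Structure G] {X : Set G}

theorem isDefinableRel_mul (hmul : (univ : Set G).Definable L {v : Fin 3 → G | v 0 * v 1 = v 2})
    (hX : IsDefinable L X) : IsDefinableRel L {p : G × G | p.1 * p.2 ∈ X} := by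
  have h3 : (univ : Set G).Definable L {v : Fin 3 → G | v 2 ∈ X} :=
    Definable.preimage_comp (![2] : Fin 1 → Fin 3) hX
  have h := (hmul.inter h3).image_comp (![0, 1] : Fin 2 → Fin 3)
  unfold IsDefinableRel Definable₂
  convert h using 1
  ext v
  simp only [mem_ofPred_eq, mem_image, mem_inter_iff]
  constructor
  · intro hv
    refine ⟨![v 0, v 1, v 0 * v 1], ⟨rfl, hv⟩, ?_⟩
    funext i
    fin_cases i <;> rfl
  · rintro ⟨u, ⟨hu, hu2⟩, rfl⟩
    simpa [← hu] using hu2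

theorem isDefinableRel_conj (hmul : (univ : Set G).Definable L {v : Fin 3 → G | v 0 * v 1 = v 2})
    (hX : IsDefinable L X) : IsDefinableRel L {p : G × G | p.1 * p.2 * p.1⁻¹ ∈ X} := by
  -- coordinates: 0 is g, 1 is y, 2 is x = g * y * g⁻¹, 3 is g * y = x * g
  have h1 := hmul.preimage_comp (![0, 1, 3] : Fin 3 → Fin 4)
  have h2 := hmul.preimage_comp (![2, 0, 3] : Fin 3 → Fin 4)
  have h3 : (univ : Set G).Definable L {v : Fin 4 → G | v 2 ∈ X} :=
    Definable.preimage_comp (![2] : Fin 1 → Fin 4) hX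
  have h := ((h1.inter h2).inter h3).image_comp (![0, 1] : Fin 2 → Fin 4)
  unfold IsDefinableRel Definable₂
  convert h using 1
  ext v
  simp only [mem_ofPred_eq, mem_image, mem_inter_iff, mem_preimage, Function.comp_apply]
  constructor
  · intro hv
    refine ⟨![v 0, v 1, v 0 * v 1 * (v 0)⁻¹, v 0 * v 1], ⟨⟨?_, ?_⟩, ?_⟩, ?_⟩
    · simp
    · simp
    · simpa using hv
    · funext i
      fin_cases i <;> rfl
  · rintro ⟨u, ⟨⟨hu1, hu2⟩, hu3⟩, rfl⟩
    have e1 : u 0 * u 1 = u 3 := by simpa using hu1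
    have e2 : u 2 * u 0 = u 3 := by simpa using hu2
    simpa [e1, ← e2] using hu3

namespace IsGroupOfFiniteMorleyRank

variable (hG : IsGroupOfFiniteMorleyRank L G)
include hG

theorem isDefinable_preimage_mul_left (hX : IsDefinable L X) (a : G) :
    IsDefinable L ((a * ·) ⁻¹' X) :=
  isDefinable_fiber (isDefinableRel_mul hG.definable_mul hX) a

theorem isDefinable_preimage_mul_right (hX : IsDefinable L X) (a : G) :
    IsDefinable L ((· * a) ⁻¹' X) :=
  isDefinable_fiber (isDefinableRel_swap (isDefinableRel_mul hG.definable_mul hX)) a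

theorem isDefinable_preimage_conj (hX : IsDefinable L X) (a : G) :
    IsDefinable L (MulAut.conj a ⁻¹' X) :=
  isDefinable_fiber (isDefinableRel_conj hG.definable_mul hX) a

end IsGroupOfFiniteMorleyRank

variable {n : ℕ}

theorem rankGE_preimage_equiv {e : Equiv.Perm G} (h : ∀ X, IsDefinable L X → IsDefinable L (e ⁻¹' X))
    (h' : ∀ X, IsDefinable L X → IsDefinable L (e.symm ⁻¹' X)) :
    RankGE (IsDefinable L) n (e ⁻¹' X) ↔ RankGE (IsDefinable L) n X := by
  rw [← e.image_symm_eq_preimage]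
  refine rankGE_image_iff e.symm.injective (fun Z hZ => ?_) h'
  rw [e.image_symm_eq_preimage]
  exact h Z hZ

theorem IsDefinable.or_of_subset_union {Y Z : Set G} (hX : IsDefinable L X) (hY : IsDefinable L Y)
    (hZ : RankGE (IsDefinable L) n Z) (h : Z ⊆ X ∪ Y) :
    RankGE (IsDefinable L) n X ∨ RankGE (IsDefinable L) n Y :=
  hZ.or_of_subset_union (fun _ _ => IsDefinable.inter) hX hY h

/-- The successive differences of a decreasing chain are pairwise disjoint. -/
theorem rankGE_succ_of_antitone {Z : ℕ → Set G} (hZ : Antitone Z) (hD : ∀ i, IsDefinable L (Z i))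
    (hr : ∀ i, RankGE (IsDefinable L) n (Z i \ Z (i + 1))) :
    RankGE (IsDefinable L) (n + 1) (Z 0) := by
  refine ⟨fun i => Z i \ Z (i + 1), fun i => ⟨(hD i).sdiff (hD _),
    sdiff_subset.trans (hZ (Nat.zero_le i)), hr i⟩, ?_⟩
  have key : ∀ i j, i < j → Disjoint (Z i \ Z (i + 1)) (Z j \ Z (j + 1)) := fun i j hij =>
    disjoint_left.2 fun x hx hx' => hx.2 (hZ hij hx'.1)
  intro i j hij
  rcases Nat.lt_or_gt_of_ne hij with h | h
  · exact key i j h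
  · exact (key j i h).symm

/-- Removing the earlier sets from `P i` makes the family disjoint, and costs only finitely many
sets that do not have rank at least `n`. -/
theorem rankGE_succ_of_almost_disjoint {P : ℕ → Set G} (hP : ∀ i, IsDefinable L (P i))
    (hr : ∀ i, RankGE (IsDefinable L) n (P i))
    (hd : ∀ i j, i ≠ j → ¬ RankGE (IsDefinable L) n (P i ∩ P j)) :
    RankGE (IsDefinable L) (n + 1) (univ : Set G) := by
  have hU : ∀ i, IsDefinable L (⋃ j < i, P j) := fun i =>
    definable_biUnion_lt isDefinable_empty (fun _ _ => IsDefinable.union) i P hP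
  refine ⟨fun i => P i \ ⋃ j < i, P j, fun i => ⟨(hP i).sdiff (hU i), subset_univ _, ?_⟩, ?_⟩
  · rcases ((hP i).sdiff (hU i)).or_of_subset_union ((hP i).inter (hU i)) (hr i)
      (sdiff_union_inter _ _).symm.subset with h | h
    · exact h
    · obtain ⟨j, hj, hij⟩ := h.exists_of_subset_biUnion_lt isDefinable_empty
        (fun _ _ => IsDefinable.inter) (fun _ _ => IsDefinable.union) i (fun j => P i ∩ P j)
        (fun j => (hP i).inter (hP j)) (by rw [inter_iUnion₂])
      exact absurd hij (hd i j hj.ne')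
  · have key : ∀ i j, i < j → Disjoint (P i \ ⋃ k < i, P k) (P j \ ⋃ k < j, P k) := fun i j hij =>
      disjoint_left.2 fun x hx hx' => hx'.2 (mem_iUnion₂.2 ⟨i, hij, hx.1⟩)
    intro i j hij
    rcases Nat.lt_or_gt_of_ne hij with h | h
    · exact key i j h
    · exact (key j i h).symm

end GroupDefinability

/-! ### Irreducible sets, stabilizers, and intersections of generic sets -/

section Degree

variable {L : Language} {G : Type*} [Group G] [L.Structure G] {A X Y : Set G} {n : ℕ}

/-- The set `A` cannot be split by a definable set into two parts of rank at least `n`. -/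
def IsIrreducible (L : Language) {G : Type*} [Group G] [L.Structure G] (n : ℕ) (A : Set G) :
    Prop :=
  ∀ B, IsDefinable L B → RankGE (IsDefinable L) n (A ∩ B) → ¬ RankGE (IsDefinable L) n (A \ B)

/-- Otherwise splitting could be repeated forever, and the resulting decreasing chain with
differences of rank `n` would force rank `n + 1`. -/
theorem exists_isIrreducible_subset (hX : IsDefinable L X) (hr : RankGE (IsDefinable L) n X)
    (hn : ¬ RankGE (IsDefinable L) (n + 1) X) :
    ∃ A ⊆ X, IsDefinable L A ∧ RankGE (IsDefinable L) n A ∧ IsIrreducible L n A := by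
  by_contra! hA
  have step : ∀ Z : {Z : Set G // Z ⊆ X ∧ IsDefinable L Z ∧ RankGE (IsDefinable L) n Z},
      ∃ Z' : {Z : Set G // Z ⊆ X ∧ IsDefinable L Z ∧ RankGE (IsDefinable L) n Z},
        Z'.1 ⊆ Z.1 ∧ RankGE (IsDefinable L) n (Z.1 \ Z'.1) := by
    rintro ⟨Z, hZX, hZ, hZr⟩
    have h := hA Z hZX hZ hZr
    unfold IsIrreducible at h
    push Not at h
    obtain ⟨B, hB, h1, h2⟩ := h
    exact ⟨⟨Z ∩ B, inter_subset_left.trans hZX, hZ.inter hB, h1⟩, inter_subset_left,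
      by rwa [sdiff_self_inter]⟩
  choose f hf using step
  let Z : ℕ → {Z : Set G // Z ⊆ X ∧ IsDefinable L Z ∧ RankGE (IsDefinable L) n Z} :=
    fun i => f^[i] ⟨X, Subset.rfl, hX, hr⟩
  have hZ : ∀ i, Z (i + 1) = f (Z i) := fun i => Function.iterate_succ_apply' f i _
  refine hn (rankGE_succ_of_antitone (Z := fun i => (Z i).1) (antitone_nat_of_succ_le fun i => ?_)
    (fun i => (Z i).2.2.1) fun i => ?_)
  · rw [hZ]
    exact (hf _).1
  · rw [hZ]
    exact (hf _).2

theorem rankGE_preimage_perm {e : G →* Equiv.Perm G}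
    (he : ∀ g X, IsDefinable L X → IsDefinable L (e g ⁻¹' X)) (g : G) :
    RankGE (IsDefinable L) n (e g ⁻¹' X) ↔ RankGE (IsDefinable L) n X :=
  rankGE_preimage_equiv (he g) (by
    have h := he g⁻¹
    rwa [map_inv] at h)

/-- By irreducibility, a large intersection of `A` with a translate means a small difference. Small
differences compose, which gives closure under products. -/
theorem IsIrreducible.exists_stabilizer (hA : IsIrreducible L n A) (hAd : IsDefinable L A)
    (hAr : RankGE (IsDefinable L) n A) (e : G →* Equiv.Perm G)
    (he : ∀ g X, IsDefinable L X → IsDefinable L (e g ⁻¹' X)) :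
    ∃ S : Subgroup G, ∀ g, g ∈ S ↔ RankGE (IsDefinable L) n (A ∩ e g ⁻¹' A) := by
  have hsmall : ∀ g, RankGE (IsDefinable L) n (A ∩ e g ⁻¹' A) ↔
      ¬ RankGE (IsDefinable L) n (A \ e g ⁻¹' A) := fun g => by
    refine ⟨hA _ (he g A hAd), fun h => ?_⟩
    exact ((hAd.inter (he g A hAd)).or_of_subset_union (hAd.sdiff (he g A hAd)) hAr
      (inter_union_sdiff _ _).symm.subset).resolve_right h
  have hone : RankGE (IsDefinable L) n (A ∩ e 1 ⁻¹' A) := by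
    rw [map_one]
    exact hAr.mono fun a ha => ⟨ha, ha⟩
  have hmul : ∀ g h, RankGE (IsDefinable L) n (A ∩ e g ⁻¹' A) →
      RankGE (IsDefinable L) n (A ∩ e h ⁻¹' A) →
      RankGE (IsDefinable L) n (A ∩ e (g * h) ⁻¹' A) := by
    intro g h hg hh
    rw [hsmall] at hg hh ⊢
    intro hgh
    rcases (hAd.sdiff (he h A hAd)).or_of_subset_union
      (he h _ (hAd.sdiff (he g A hAd))) hgh (by
        rintro a ⟨ha, ha'⟩
        by_cases hb : e h a ∈ A
        · refine Or.inr ⟨hb, fun hc => ha' ?_⟩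
          rw [map_mul]
          exact hc
        · exact Or.inl ⟨ha, hb⟩) with h1 | h1
    · exact hh h1
    · exact hg ((rankGE_preimage_perm he h).1 h1)
  have hinv : ∀ g, RankGE (IsDefinable L) n (A ∩ e g ⁻¹' A) →
      RankGE (IsDefinable L) n (A ∩ e g⁻¹ ⁻¹' A) := by
    intro g hg
    rw [← rankGE_preimage_perm he g]
    refine hg.mono ?_
    rintro a ⟨ha, ha'⟩
    refine ⟨ha', ?_⟩
    rw [map_inv]
    simpa using ha
  exact ⟨⟨⟨⟨{g | RankGE (IsDefinable L) n (A ∩ e g ⁻¹' A)}, fun {g h} => hmul g h⟩, hone⟩,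
    fun {g} => hinv g⟩, fun g => Iff.rfl⟩

/-- A definable action of a connected group on itself stabilizes the generic type that concentrates
on an irreducible set. -/
theorem IsIrreducible.rankGE_inter_preimage (hG : IsGroupOfFiniteMorleyRank L G)
    (hconn : IsConnected L (⊤ : Subgroup G)) (hn : ¬ RankGE (IsDefinable L) (n + 1) (univ : Set G))
    (hA : IsIrreducible L n A) (hAd : IsDefinable L A) (hAr : RankGE (IsDefinable L) n A)
    (e : G →* Equiv.Perm G)
    (he : ∀ X, IsDefinable L X → IsDefinableRel L {p : G × G | e p.1 p.2 ∈ X}) (g : G) :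
    RankGE (IsDefinable L) n (A ∩ e g ⁻¹' A) := by
  have hed : ∀ g X, IsDefinable L X → IsDefinable L (e g ⁻¹' X) := fun g X hX =>
    isDefinable_fiber (he X hX) g
  obtain ⟨S, hS⟩ := hA.exists_stabilizer hAd hAr e hed
  have hSd : IsDefinable L (S : Set G) := by
    -- As no subset of `G` has rank above `n`, rank at least `n` is rank exactly `n`, which is a
    -- definable condition on fibres.
    have h := hG.ranked.isDefinable_hasRank_fiber
      (isDefinableRel_inter hAd.snd (he A hAd)) n
    refine (congrArg _ (Set.ext fun g => ?_)).mp h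
    exact ⟨fun h => (hS g).2 h.1, fun h => ⟨(hS g).1 h, fun h' => hn (h'.mono (subset_univ _))⟩⟩
  refine (hS g).1 (hconn S hSd ?_ (Subgroup.mem_top g))
  rw [Subgroup.relIndex_top_right]
  intro hidx
  have := Subgroup.index_eq_zero_iff_infinite.1 hidx
  let q := Infinite.natEmbedding (G ⧸ S)
  -- Translates of `A` by representatives of distinct cosets of `S` are almost disjoint, so infinite
  -- index would push the rank of `G` above `n`.
  refine hn (rankGE_succ_of_almost_disjoint (P := fun i => e (q i).out⁻¹ ⁻¹' A)
    (fun i => hed _ _ hAd) (fun i => (rankGE_preimage_perm hed _).2 hAr)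
    fun i j hij h => hij (q.injective ?_))
  rw [← Quotient.out_eq' (q i), ← Quotient.out_eq' (q j)]
  refine QuotientGroup.eq.2 ((hS _).2 ?_)
  rw [← rankGE_preimage_perm hed (q j).out⁻¹]
  refine h.mono ?_
  rintro a ⟨ha, ha'⟩
  refine ⟨ha', ?_⟩
  simp only [map_mul, map_inv, mem_preimage] at ha ⊢
  simpa using ha

theorem isDefinableRel_mul_right (hG : IsGroupOfFiniteMorleyRank L G) (hX : IsDefinable L X) :
    IsDefinableRel L {p : G × G | p.2 * p.1⁻¹ ∈ X} := by
  have h1 := hG.definable_mul.preimage_comp (![2, 0, 1] : Fin 3 → Fin 3)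
  have h3 : (univ : Set G).Definable L {v : Fin 3 → G | v 2 ∈ X} :=
    Definable.preimage_comp (![2] : Fin 1 → Fin 3) hX
  have h := (h1.inter h3).image_comp (![0, 1] : Fin 2 → Fin 3)
  unfold IsDefinableRel Definable₂
  convert h using 1
  ext v
  simp only [mem_ofPred_eq, mem_image, mem_inter_iff, mem_preimage, Function.comp_apply]
  constructor
  · intro hv
    refine ⟨![v 0, v 1, v 1 * (v 0)⁻¹], ⟨by simp, hv⟩, ?_⟩
    funext i
    fin_cases i <;> rfl
  · rintro ⟨u, ⟨hu, hu2⟩, rfl⟩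
    have e1 : u 2 * u 0 = u 1 := by simpa using hu
    simpa [← e1] using hu2

/-- Generic definable subsets of a connected group meet. -/
theorem inter_nonempty_of_rankGE (hG : IsGroupOfFiniteMorleyRank L G)
    (hconn : IsConnected L (⊤ : Subgroup G)) (hn : ¬ RankGE (IsDefinable L) (n + 1) (univ : Set G))
    (hX : IsDefinable L X) (hY : IsDefinable L Y) (hXr : RankGE (IsDefinable L) n X)
    (hYr : RankGE (IsDefinable L) n Y) : (X ∩ Y).Nonempty := by
  obtain ⟨A, hAX, hA, hAr, hirr⟩ := exists_isIrreducible_subset hX hXr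
    fun h => hn (h.mono (subset_univ _))
  by_contra hXY
  have hAY : A ∩ Y = ∅ := by
    rw [← subset_empty_iff, ← not_nonempty_iff_eq_empty.1 hXY]
    exact inter_subset_inter_left Y hAX
  have hleft : ∀ g, RankGE (IsDefinable L) n (A ∩ (g * ·) ⁻¹' A) :=
    hirr.rankGE_inter_preimage hG hconn hn hA hAr (MulAction.toPermHom G G)
      fun X hX => isDefinableRel_mul hG.definable_mul hX
  have hright : ∀ g, RankGE (IsDefinable L) n (A ∩ (· * g) ⁻¹' A) := fun g => by
    have h := hirr.rankGE_inter_preimage hG hconn hn hA hAr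
      -- The inverse turns right multiplication into a homomorphism to permutations; applying it at
      -- `g⁻¹` undoes this.
      { toFun := fun g => Equiv.mulRight g⁻¹
        map_one' := by ext; simp
        map_mul' := by intros; ext; simp [mul_assoc] }
      (fun X hX => isDefinableRel_mul_right hG hX) g⁻¹
    simpa using h
  -- The rank of `R` is computed in two ways. Right translates of `A` nearly equal `A`, so fibres
  -- over `Y` have rank `n`. Left translates do too, and `A` misses `Y`, so fibres over `A` have
  -- smaller rank.
  let R : Set (G × G) := {p | p.1 ∈ A} ∩ {p | p.2 ∈ Y} ∩ {p | p.1 * p.2 ∈ A}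
  have hR : IsDefinableRel L R := isDefinableRel_inter (isDefinableRel_inter hA.fst hY.snd)
    (isDefinableRel_mul hG.definable_mul hA)
  -- the fibres over `Y` are generic
  have hlarge : RankGE (IsDefinableRel L) (n + n) R := by
    rw [← IsRanked.rankGE_swap]
    refine hG.ranked.rankGE_rel (isDefinableRel_swap hR) (hYr.mono fun y hy => ?_) ?_
    · obtain ⟨x, hx, hx'⟩ := (hright y).nonempty
      exact ⟨x, ⟨hx, hy⟩, hx'⟩
    · rintro y x ⟨⟨-, hy⟩, -⟩
      exact (hright y).mono fun z hz => ⟨⟨hz.1, hy⟩, hz.2⟩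
  -- the fibres over `A` are not
  have hfib : ∀ x, ¬ RankGE (IsDefinable L) n {y | (x, y) ∈ R} := by
    intro x h
    have hxA := hG.isDefinable_preimage_mul_left hA x
    have h1 : RankGE (IsDefinable L) n ((x * ·) ⁻¹' A \ A) := h.mono fun y hy =>
      ⟨hy.2, fun hyA => (hAY.subset ⟨hyA, hy.1.2⟩ : y ∈ (∅ : Set G))⟩
    have h2 : RankGE (IsDefinable L) n (A \ (x⁻¹ * ·) ⁻¹' A) := by
      have hl : ∀ g X, IsDefinable L X → IsDefinable L (Equiv.mulLeft g ⁻¹' X) :=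
        fun g X hX => hG.isDefinable_preimage_mul_left hX g
      rw [← rankGE_preimage_equiv (e := Equiv.mulLeft x) (hl x)
        (by rw [Equiv.mulLeft_symm]; exact hl x⁻¹)]
      convert h1 using 1
      ext y
      simp
    exact hirr _ (hG.isDefinable_preimage_mul_left hA x⁻¹) (hleft x⁻¹) h2
  -- In rank zero, "not of rank at least `n`" means empty; otherwise the fibres have rank at most
  -- `k`, and `R` has rank below `n + n`.
  cases n with
  | zero =>
    obtain ⟨⟨x, y⟩, hxy⟩ := hlarge.nonempty
    exact hfib x ⟨y, hxy⟩
  | succ k =>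
    refine hG.ranked.not_rankGE_rel (m := k + 1) (n := k) hR
      (fun h => hn (h.mono (subset_univ _))) hfib ?_
    exact hlarge.of_le (by omega)

end Degree

/-! ### Finite index along the upper central series -/

section NilpotentGroups

variable {Q : Type*} [Group Q]

/-- In a group, the elements of `K` that centralize `x` modulo a normal subgroup `N` form a
subgroup of finite index in `K`, if their commutators with `x` lie in a subgroup `Z` in which `N`
has finite index. -/
theorem relIndex_centralizer_mod_ne_zero {N Z K : Subgroup Q} [N.Normal] {x : Q}
    (hN : N.relIndex Z ≠ 0) (hK : ∀ v ∈ K, v * x * v⁻¹ * x⁻¹ ∈ Z) :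
    (K ⊓ (Subgroup.centralizer {(x : Q ⧸ N)}).comap (QuotientGroup.mk' N)).relIndex K ≠ 0 := by
  rw [Subgroup.inf_relIndex_left]
  have hfin : (N.subgroupOf Z).FiniteIndex := ⟨hN⟩
  -- Elements `p`, `q` of `K` having the same commutator with `x` modulo `N` differ by `p⁻¹ * q`,
  -- which centralizes `x` modulo `N`. So cosets inject into the finite quotient of `Z`.
  let f : K ⧸ ((Subgroup.centralizer {(x : Q ⧸ N)}).comap (QuotientGroup.mk' N)).subgroupOf K →
      Z ⧸ N.subgroupOf Z := fun q => QuotientGroup.mk ⟨_, hK q.out q.out.2⟩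
  have hf : Function.Injective f := by
    intro p q hpq
    rw [← Quotient.out_eq' p, ← Quotient.out_eq' q]
    refine QuotientGroup.eq.2 ?_
    have h : (p.out * x * (p.out : Q)⁻¹ * x⁻¹ : Q)⁻¹ * (q.out * x * (q.out : Q)⁻¹ * x⁻¹) ∈ N :=
      Subgroup.mem_subgroupOf.1 (QuotientGroup.eq.1 hpq)
    rw [← QuotientGroup.eq] at h
    simp only [QuotientGroup.mk_mul, QuotientGroup.mk_inv, mul_left_inj] at h
    rw [Subgroup.mem_subgroupOf, Subgroup.mem_comap, Subgroup.mem_centralizer_singleton_iff]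
    simp only [Subgroup.coe_mul, Subgroup.coe_inv, map_mul, map_inv, QuotientGroup.mk'_apply]
    generalize ((p.out : Q) : Q ⧸ N) = a at h ⊢
    generalize ((q.out : Q) : Q ⧸ N) = b at h ⊢
    have hb : b * x = a * x * a⁻¹ * b := by rw [h, inv_mul_cancel_right]
    rw [mul_assoc, hb]
    group
  have := Finite.of_injective f hf
  exact Subgroup.index_ne_zero_of_finite

/-- The group-theoretic core, with the model theory isolated in two hypotheses: `hV` comes from the
rank bound on conjugators, `hcore` from the chain condition. Passing to the normal core makes it
possible to centralize `x` modulo a subgroup of `H`. -/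
theorem index_ne_zero_of_isNilpotent [Group.IsNilpotent Q] (H : Subgroup Q) (x : Q)
    (hV : ∀ V : Subgroup Q, (∀ v ∈ V, v * x * v⁻¹ * x⁻¹ ∈ H) → H.relIndex V ≠ 0)
    (hcore : ∀ Z : Subgroup Q, Z.Normal → H.relIndex Z ≠ 0 → H.normalCore.relIndex Z ≠ 0) :
    H.index ≠ 0 := by
  have key : ∀ i, H.relIndex (Subgroup.upperCentralSeries Q i) ≠ 0 := by
    intro i
    induction i with
    | zero => simp
    | succ i ih =>
      have hrel := relIndex_centralizer_mod_ne_zero (x := x)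
        (hcore _ inferInstance ih) (K := Subgroup.upperCentralSeries Q (i + 1))
        fun v hv => Subgroup.mem_upperCentralSeries_succ_iff.1 hv x
      refine Subgroup.relIndex_ne_zero_trans (hV _ ?_) hrel
      rintro v ⟨-, hv⟩
      have hv : (v : Q ⧸ H.normalCore) * x = x * v :=
        Subgroup.mem_centralizer_singleton_iff.1 (Subgroup.mem_comap.1 hv)
      refine H.normalCore_le ((QuotientGroup.eq_one_iff _).1 ?_)
      simp [hv]
  obtain ⟨n, hn⟩ := Group.IsNilpotent.nilpotent Q
  have h := key n
  rwa [hn, Subgroup.relIndex_top_right] at h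

end NilpotentGroups

/-! ### The descending chain condition on definable subgroups -/

section ChainCondition

variable {L : Language} {G : Type*} [Group G] [L.Structure G] {H : Subgroup G}

theorem rankGE_preimage_mul_left (hG : IsGroupOfFiniteMorleyRank L G) (a : G) {X : Set G} {n : ℕ} :
    RankGE (IsDefinable L) n ((a * ·) ⁻¹' X) ↔ RankGE (IsDefinable L) n X :=
  rankGE_preimage_equiv (e := Equiv.mulLeft a)
    (fun _ hX => hG.isDefinable_preimage_mul_left hX a)
    (by rw [Equiv.mulLeft_symm]; exact fun _ hX => hG.isDefinable_preimage_mul_left hX a⁻¹)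

theorem rankGE_preimage_mul_right (hG : IsGroupOfFiniteMorleyRank L G) (a : G) {X : Set G} {n : ℕ} :
    RankGE (IsDefinable L) n ((· * a) ⁻¹' X) ↔ RankGE (IsDefinable L) n X :=
  rankGE_preimage_equiv (e := Equiv.mulRight a)
    (fun _ hX => hG.isDefinable_preimage_mul_right hX a)
    (by rw [Equiv.mulRight_symm]; exact fun _ hX => hG.isDefinable_preimage_mul_right hX a⁻¹)

theorem rankGE_preimage_conj (hG : IsGroupOfFiniteMorleyRank L G) (a : G) {X : Set G} {n : ℕ} :
    RankGE (IsDefinable L) n (MulAut.conj a ⁻¹' X) ↔ RankGE (IsDefinable L) n X :=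
  rankGE_preimage_equiv (e := (MulAut.conj a).toEquiv)
    (fun _ hX => hG.isDefinable_preimage_conj hX a) fun X hX => by
      have h := hG.isDefinable_preimage_conj hX a⁻¹
      rwa [map_inv] at h

/-- The difference contains a whole coset of `C`. -/
theorem exists_rankGE_diff_of_lt (hG : IsGroupOfFiniteMorleyRank L G) {n : ℕ} {C D : Subgroup G}
    (hCD : C < D) (hC : RankGE (IsDefinable L) n (C : Set G)) :
    RankGE (IsDefinable L) n ((D : Set G) \ C) := by
  obtain ⟨hle, a, ha, haC⟩ := SetLike.lt_iff_le_and_exists.1 hCD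
  refine ((rankGE_preimage_mul_left hG a⁻¹).2 hC).mono fun x hx => ⟨?_, fun hxC => haC ?_⟩
  · simpa using D.mul_mem ha (hle hx)
  · simpa using C.mul_mem hxC (C.inv_mem hx)

/-- By the descending chain condition on definable subgroups, a nonempty family of definable
subgroups that is closed under intersections has a least element. -/
theorem exists_least_definable_subgroup (hG : IsGroupOfFiniteMorleyRank L G)
    (F : Set (Subgroup G)) (hF : ∀ D ∈ F, IsDefinable L (D : Set G)) (hne : F.Nonempty)
    (hinf : ∀ C ∈ F, ∀ D ∈ F, C ⊓ D ∈ F) : ∃ C ∈ F, ∀ D ∈ F, C ≤ D := by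
  classical
  have hrank : ∀ D ∈ F, ∃ n, HasRank (IsDefinable L) (D : Set G) n := fun D hD =>
    hG.ranked.exists_hasRank (hF D hD) ⟨1, D.one_mem⟩
  have hex : ∃ n, ∃ D ∈ F, HasRank (IsDefinable L) (D : Set G) n := by
    obtain ⟨D, hD⟩ := hne
    obtain ⟨n, hn⟩ := hrank D hD
    exact ⟨n, D, hD, hn⟩
  -- Starting from a member of minimal rank, every further member has at least this rank, so an
  -- infinite strict descent would raise the rank of `C` by one.
  obtain ⟨C, hC, hCr⟩ := Nat.find_spec hex
  have hmin : ∀ D ∈ F, RankGE (IsDefinable L) (Nat.find hex) (D : Set G) := fun D hD => by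
    obtain ⟨n, hn⟩ := hrank D hD
    exact hn.1.of_le (Nat.find_min' hex ⟨D, hD, hn⟩)
  by_contra! hno
  have step : ∀ D : F, ∃ D' : F, D'.1 < D.1 := by
    rintro ⟨D, hD⟩
    obtain ⟨E, hE, hDE⟩ := hno D hD
    exact ⟨⟨D ⊓ E, hinf D hD E hE⟩, inf_lt_left.2 hDE⟩
  choose f hf using step
  let Z : ℕ → F := fun i => f^[i] ⟨C, hC⟩
  have hZ : ∀ i, (Z (i + 1)).1 < (Z i).1 := fun i => by
    rw [show Z (i + 1) = f (Z i) from Function.iterate_succ_apply' f i _]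
    exact hf _
  exact hCr.2 (rankGE_succ_of_antitone (Z := fun i => ((Z i).1 : Set G))
    (antitone_nat_of_succ_le fun i => (hZ i).le) (fun i => hF _ (Z i).2)
    fun i => exists_rankGE_diff_of_lt hG (hZ i) (hmin _ (Z (i + 1)).2))

/-- The definable subgroups meeting `Z` in finite index have a least member, although `Q` and `Z`
need not be definable. As `Z` is normal in `Q`, all `Q`-conjugates of `H` are in the family, so this
member's trace on `Q` lies in the core. -/
theorem relIndex_normalCore_ne_zero (hG : IsGroupOfFiniteMorleyRank L G)
    (hH : IsDefinable L (H : Set G)) (Q : Subgroup G) (Z : Subgroup Q) (hZ : Z.Normal)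
    (h : (H.subgroupOf Q).relIndex Z ≠ 0) : (H.subgroupOf Q).normalCore.relIndex Z ≠ 0 := by
  obtain ⟨C, ⟨-, hC⟩, hle⟩ := exists_least_definable_subgroup hG
    {D | IsDefinable L (D : Set G) ∧ (D.subgroupOf Q).relIndex Z ≠ 0} (fun D hD => hD.1)
    ⟨H, hH, h⟩ fun C hC D hD => by
      obtain ⟨hC1, hC2⟩ := hC
      obtain ⟨hD1, hD2⟩ := hD
      refine ⟨?_, ?_⟩
      · rw [Subgroup.coe_inf]
        exact hC1.inter hD1
      · rw [show (C ⊓ D).subgroupOf Q = C.subgroupOf Q ⊓ D.subgroupOf Q from Subgroup.comap_inf ..]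
        exact Subgroup.relIndex_inf_ne_zero hC2 hD2
  have hCcore : C.subgroupOf Q ≤ (H.subgroupOf Q).normalCore := by
    intro a ha b
    refine hle (H.comap (MulAut.conj (b : G)).toMonoidHom)
      ⟨hG.isDefinable_preimage_conj hH b, ?_⟩ ha
    have h1 : (H.comap (MulAut.conj (b : G)).toMonoidHom).subgroupOf Q =
        (H.subgroupOf Q).comap (MulAut.conj b).toMonoidHom := rfl
    have h2 : Z.map (MulAut.conj b).toMonoidHom = Z :=
      Subgroup.Normal.conj_smul_eq_self b Z
    have h3 : ((H.subgroupOf Q).comap (MulAut.conj b).toMonoidHom).relIndex Z ≠ 0 := by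
      rw [Subgroup.relIndex_comap, h2]
      exact h
    rwa [← h1] at h3
  exact fun h0 => hC (Subgroup.relIndex_eq_zero_of_le_left hCcore h0)

end ChainCondition

/-! ### Generic elements, generous sets and their conjugators -/

section Generic

variable {L : Language} {G : Type*} [Group G] [L.Structure G] {H : Subgroup G} {n : ℕ} {X Y : Set G}

theorem isGeneric_of_rankGE (hn : HasRank (IsDefinable L) (univ : Set G) n)
    (hX : IsDefinable L X) (hr : RankGE (IsDefinable L) n X) : IsGeneric L X :=
  ⟨hX, n, ⟨hr, fun h => hn.2 (h.mono (subset_univ _))⟩, hn⟩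

theorem IsGeneric.rankGE (hX : IsGeneric L X) (hn : HasRank (IsDefinable L) (univ : Set G) n) :
    RankGE (IsDefinable L) n X := by
  obtain ⟨-, m, hm, hm'⟩ := hX
  exact hm'.eq_of_hasRank hn ▸ hm.1

theorem rankGE_inter_sInter_of_finite (hY : IsDefinable L Y) (hr : RankGE (IsDefinable L) n Y)
    {F : Set (Set G)} (hF : F.Finite)
    (h : ∀ X ∈ F, IsDefinable L X ∧ ¬ RankGE (IsDefinable L) n (Y \ X)) :
    IsDefinable L (Y ∩ ⋂₀ F) ∧ RankGE (IsDefinable L) n (Y ∩ ⋂₀ F) := by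
  induction F, hF using Set.Finite.induction_on with
  | empty => simpa using ⟨hY, hr⟩
  | @insert X F _ _ ih =>
    obtain ⟨hd, hr⟩ := ih fun Z hZ => h Z (mem_insert_of_mem _ hZ)
    obtain ⟨hX, hXr⟩ := h X (mem_insert _ _)
    rw [sInter_insert, inter_left_comm]
    refine ⟨hX.inter hd, ((hX.inter hd).or_of_subset_union (hY.sdiff hX) hr ?_).resolve_right hXr⟩
    intro x hx
    by_cases hxX : x ∈ X
    · exact Or.inl ⟨hxX, hx⟩
    · exact Or.inr ⟨hx.1, hxX⟩

/-- In a saturated group, every generic definable set contains realizations of the generic type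
over any small set of parameters. -/
theorem exists_isGenericOver_mem (hn : HasRank (IsDefinable L) (univ : Set G) n) {κ : Cardinal}
    (hκ : Cardinal.aleph0 ≤ κ) (hsat : IsSaturated L G κ) {A : Set G} (hA : Cardinal.mk A < κ)
    (hY : IsDefinable L Y) (hr : RankGE (IsDefinable L) n Y) : ∃ g ∈ Y, IsGenericOver L A g := by
  -- `Y` needs only finitely many extra parameters, so adding them to `A` stays below the infinite
  -- cardinal `κ`.
  obtain ⟨A₀, -, hA₀⟩ := definable_iff_finitely_definable.1 hY
  let F : Set (Set G) := insert Y {X | A.Definable₁ L X ∧ ¬ IsGeneric L Xᶜ}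
  have hF : ∀ X ∈ F, (A ∪ A₀).Definable₁ L X := by
    rintro X (rfl | hX)
    · exact Definable.mono hA₀ subset_union_right
    · exact Definable.mono hX.1 subset_union_left
  obtain ⟨g, hg⟩ := hsat (A ∪ A₀) ((Cardinal.mk_union_le _ _).trans_lt
    (Cardinal.add_lt_of_lt hκ hA ((Cardinal.lt_aleph0_of_finite _).trans_le hκ))) F hF
    fun F₀ hF₀ hfin => by
      refine ((rankGE_inter_sInter_of_finite hY hr hfin fun X hX => ?_).2.nonempty).mono
        inter_subset_right
      refine ⟨Definable.mono (hF X (hF₀ hX)) (subset_univ _), fun h => ?_⟩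
      rcases hF₀ hX with rfl | hX
      · simpa using h.nonempty
      · exact hX.2 (isGeneric_of_rankGE hn
          (IsDefinable.compl (Definable.mono hX.1 (subset_univ _))) (h.mono fun x hx => hx.2))
  refine ⟨g, hg Y (mem_insert _ _), fun X hX hXg hgX => ?_⟩
  refine hg Xᶜ (mem_insert_of_mem _ ⟨Definable.compl hX, ?_⟩) hgX
  rwa [compl_compl]

theorem Generically.exists_mem (hG : IsGroupOfFiniteMorleyRank L G)
    (hconn : IsConnected L (⊤ : Subgroup G)) (hn : HasRank (IsDefinable L) (univ : Set G) n)
    {P : G → Prop} (hP : Generically L P) (hY : IsDefinable L Y)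
    (hr : RankGE (IsDefinable L) n Y) : ∃ g ∈ Y, P g := by
  rcases hP with ⟨X, hX, hXP⟩ | ⟨κ, hκ, hsat, A, hA, hAP⟩
  · obtain ⟨g, hgX, hgY⟩ := inter_nonempty_of_rankGE hG hconn hn.2 hX.1 hY (hX.rankGE hn) hr
    exact ⟨g, hgY, hXP g hgX⟩
  · obtain ⟨g, hgY, hg⟩ := exists_isGenericOver_mem hn hκ hsat hA hY hr
    exact ⟨g, hgY, hAP g hg⟩

/-- If a definable set `X` of rank at most `r` is generous, then generically the elements of `G`
have a conjugate in `X`, and the set of the conjugating elements has rank at most `r`. -/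
theorem exists_rankGE_conjugators (hG : IsGroupOfFiniteMorleyRank L G)
    (hn : HasRank (IsDefinable L) (univ : Set G) n) (hX : IsDefinable L X) {r : ℕ}
    (hr : ¬ RankGE (IsDefinable L) (r + 1) X) (hgen : IsGenerous L X) :
    ∃ Y, IsDefinable L Y ∧ RankGE (IsDefinable L) n Y ∧ ∀ y ∈ Y, (∃ g, g * y * g⁻¹ ∈ X) ∧
      ¬ RankGE (IsDefinable L) (r + 1) {g | g * y * g⁻¹ ∈ X} := by
  have hR := isDefinableRel_conj hG.definable_mul hX
  have hR' := isDefinableRel_swap hR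
  let Y : Set G := ⋃ i < r + 1, {y | HasRank (IsDefinable L) {g | g * y * g⁻¹ ∈ X} i}
  have hY : IsDefinable L Y := definable_biUnion_lt isDefinable_empty
    (fun _ _ => IsDefinable.union) _ _ (hG.ranked.isDefinable_hasRank_fiber hR')
  have hYX : ∀ y ∈ Y, (∃ g, g * y * g⁻¹ ∈ X) ∧
      ¬ RankGE (IsDefinable L) (r + 1) {g | g * y * g⁻¹ ∈ X} := by
    intro y hy
    obtain ⟨i, hi, hy⟩ := mem_iUnion₂.1 hy
    exact ⟨hy.1.nonempty, fun h => hy.2 (h.of_le (by omega))⟩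
  refine ⟨Y, hY, ?_, hYX⟩
  have hC := hgen.1
  rcases hY.or_of_subset_union (hC.sdiff hY) (hgen.rankGE hn) (by
    rw [union_sdiff_self]; exact subset_union_right) with h | h
  · exact h
  exfalso
  -- Over the conjugates of `X` outside `Y` the fibres have rank at least `r + 1`; were these
  -- conjugates generic, the relation would have rank at least `n + r + 1`. Its fibre over `g` is a
  -- conjugate of `X`, so its rank is at most `n + r`.
  have hlow := hG.ranked.rankGE_rel (n := r + 1) (isDefinableRel_inter hR' (hC.sdiff hY).fst)
    (h.mono ?_) ?_
  · refine hG.ranked.not_rankGE_rel hR (m := n) (n := r) (fun h => hn.2 (h.mono (subset_univ _)))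
      (fun g h => hr ((rankGE_preimage_conj hG g).1 h)) ?_
    rw [← IsRanked.rankGE_swap]
    exact hlow.mono inter_subset_left
  · rintro y hy
    obtain ⟨g, x, hx, rfl⟩ := hy.1
    exact ⟨g, by simpa [mul_assoc] using hx, hy⟩
  · rintro y g ⟨hg, hy⟩
    have hfib := isDefinable_fiber hR' y
    obtain ⟨i, hi⟩ := hG.ranked.exists_hasRank hfib ⟨g, hg⟩
    have hir : r + 1 ≤ i := by
      by_contra hlt
      exact hy.2 (mem_iUnion₂.2 ⟨i, by omega, hi⟩)
    exact (hi.1.of_le hir).mono fun z hz => ⟨hz, hy⟩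

/-- A subgroup contained in a definable set of rank at most `rk H` that is a union of cosets of `H`
meets `H` in a subgroup of finite index. -/
theorem relIndex_ne_zero_of_subset (hG : IsGroupOfFiniteMorleyRank L G)
    (hH : IsDefinable L (H : Set G)) {r : ℕ} (hr : RankGE (IsDefinable L) r (H : Set G))
    {E : Set G} (hE : ¬ RankGE (IsDefinable L) (r + 1) E) (hHE : ∀ h ∈ H, ∀ g ∈ E, h * g ∈ E)
    {V : Subgroup G} (hV : (V : Set G) ⊆ E) : H.relIndex V ≠ 0 := by
  intro h
  have := Subgroup.index_eq_zero_iff_infinite.1 h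
  -- The cosets of `H` through the inverses of the representatives are disjoint, of rank at least
  -- `r`, and contained in `E`.
  refine hE (RankGE.succ_of_infinite
    (fun q : V ⧸ H.subgroupOf V => (· * (q.out : G)) ⁻¹' (H : Set G))
    (fun q => hG.isDefinable_preimage_mul_right hH _) (fun q g hg => ?_)
    (fun q => (rankGE_preimage_mul_right hG _).2 hr) fun p q hpq => ?_)
  · simpa using hHE _ hg _ (hV (V.inv_mem q.out.2))
  · refine disjoint_left.2 fun g hp hq => hpq ?_
    rw [← Quotient.out_eq' p, ← Quotient.out_eq' q]
    refine QuotientGroup.eq.2 (Subgroup.mem_subgroupOf.2 ?_)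
    have := H.mul_mem (H.inv_mem hp) hq
    simpa [mul_assoc] using this

theorem InConnectedNilpotent.conj (hG : IsGroupOfFiniteMorleyRank L G) {y : G}
    (hy : InConnectedNilpotent L y) (g : G) : InConnectedNilpotent L (g * y * g⁻¹) := by
  obtain ⟨Q, hQ, hnil, hyQ⟩ := hy
  refine ⟨Q.map (MulAut.conj g).toMonoidHom, fun D hD hDQ => ?_, ?_, y, hyQ, rfl⟩
  · rw [← Subgroup.relIndex_comap] at hDQ
    exact Subgroup.map_le_iff_le_comap.2 (hQ _ (hG.isDefinable_preimage_conj hD g) hDQ)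
  · exact Group.nilpotent_of_mulEquiv
      (Q.equivMapOfInjective (MulAut.conj g).toMonoidHom (MulAut.conj g).injective)

end Generic

end RankedGroup

/-! ### Generous cosets against connected nilpotent subgroups -/

theorem mainTheorem1 (L : FirstOrder.Language) (G : Type*) [Group G] [L.Structure G]
    (hG : RankedGroup.IsGroupOfFiniteMorleyRank L G)
    (hconn : RankedGroup.IsConnected L (⊤ : Subgroup G))
    (hgen : RankedGroup.Generically L (fun g : G => RankedGroup.InConnectedNilpotent L g))
    (H : Subgroup G) (hH : RankedGroup.IsDefinable L (H : Set G))
    (w : G) (hw : w ∈ Subgroup.normalizer (H : Set G)) (hwH : w ∉ H) :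
    ¬ RankedGroup.IsGenerous L ((fun h : G => w * h) '' (H : Set G)) := by
  open RankedGroup in
  intro hgenerous
  obtain ⟨n, hn⟩ := hG.ranked.exists_hasRank isDefinable_univ univ_nonempty
  obtain ⟨r, hr⟩ := hG.ranked.exists_hasRank hH ⟨1, H.one_mem⟩
  have hcoset : (fun h : G => w * h) '' (H : Set G) = (w⁻¹ * ·) ⁻¹' (H : Set G) := by
    ext x
    simp
  rw [hcoset] at hgenerous
  obtain ⟨Y, hY, hYr, hYX⟩ := exists_rankGE_conjugators hG hn
    (hG.isDefinable_preimage_mul_left hH w⁻¹)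
    (fun h => hr.2 ((rankGE_preimage_mul_left hG _).1 h)) hgenerous
  obtain ⟨y, hyY, hy⟩ := hgen.exists_mem hG hconn hn hY hYr
  obtain ⟨⟨g, hg⟩, hEy⟩ := hYX y hyY
  obtain ⟨Q, hQ, hnil, hxQ⟩ := hy.conj hG g
  set x := g * y * g⁻¹ with hx
  have hxw : w⁻¹ * x ∈ H := hg
  have hxH : x ∉ H := fun h => hwH (by simpa using H.mul_mem h (H.inv_mem hxw))
  -- the elements that conjugate `x` into `w * H`
  let E : Set G := {v | w⁻¹ * (v * x * v⁻¹) ∈ H}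
  have hE : ¬ RankGE (IsDefinable L) (r + 1) E := by
    -- `v` conjugates `x` into `w * H` exactly when `v * g` conjugates `y` there, so `E` is a right
    -- translate of the conjugators of `y`.
    rw [← rankGE_preimage_mul_right hG g] at hEy
    convert hEy using 2
    ext v
    change w⁻¹ * (v * (g * y * g⁻¹) * v⁻¹) ∈ H ↔ w⁻¹ * (v * g * y * (v * g)⁻¹) ∈ H
    simp only [mul_inv_rev, mul_assoc]
  have hHE : ∀ h ∈ H, ∀ v ∈ E, h * v ∈ E := by
    intro h hh v hv
    have h1 : w⁻¹ * h * w ∈ H := (Subgroup.mem_normalizer_iff''.1 hw h).1 hh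
    have h2 := H.mul_mem (H.mul_mem h1 hv) (H.inv_mem hh)
    change w⁻¹ * (h * v * x * (h * v)⁻¹) ∈ H
    convert h2 using 1
    group
  have hQH : H.relIndex Q ≠ 0 := by
    refine index_ne_zero_of_isNilpotent (H.subgroupOf Q) ⟨x, hxQ⟩ (fun V hV => ?_)
      (relIndex_normalCore_ne_zero hG hH Q)
    have h1 : H.relIndex (V.map Q.subtype) ≠ 0 := by
      refine relIndex_ne_zero_of_subset hG hH hr.1 hE hHE ?_
      rintro _ ⟨v, hv, rfl⟩
      have h2 : (v * x * (v : G)⁻¹ * x⁻¹ : G) ∈ H := hV v hv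
      -- If the commutator of `v` and `x` is in `H`, then `v * x * v⁻¹ ∈ H * x`, and `H * x` is `w *
      -- H` because `w` normalizes `H`.
      have h3 := H.mul_mem ((Subgroup.mem_normalizer_iff''.1 hw _).1 h2) hxw
      change w⁻¹ * (v * x * (v : G)⁻¹) ∈ H
      convert h3 using 1
      group
    rwa [← Subgroup.relIndex_comap] at h1
  exact hxH (hQ H hH hQH hxQ)
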